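/- **Theorem (comonotonic lower bound).** *Model.* There are one risk-free asset with rate $r$ and $m$ risky assets with drifts $\mu_j$ and volatilities $\sigma_j$. Let $\mathfrak B'_1,\dots,\mathfrak B'_m$ be jointly Gaussian standard Brownian motions with $\mathrm{Cov}(\mathfrak B'_i(s),\mathfrak B'_j(t))=\rho_{ij}\min(s,t)$. Let $\mathcal N,\mathcal N_1,\dots,\mathcal N_m$ be Poisson processes with intensities $\lambda,\lambda_1,\dots,\lambda_m$, counting the common and the individual jumps. Let $\mathcal Z_{k,j,\ell}$ ($k\ge1$, $1\le j\le m$, $\ell\in\{0,1\}$) be the jump sizes ($\ell=0$: common jumps, $\ell=1$: individual jumps), identically distributed in $k$ with $\mathbb E e^{\mathcal Z_{1,j,\ell}}<\infty$. The vector process $\mathfrak B'$, the processes $\mathcal N,\mathcal N_1,\dots,\mathcal N_m$ and all the $\mathcal Z_{k,j,\ell}$ are mutually independent. Put $h_{j,\ell}=\mathbb E e^{\mathcal Z_{1,j,\ell}}-1$ and $A_j=\mu_j-\lambda h_{j,0}-\lambda_jh_{j,1}$. Let $x\in\mathbb R^m$ (the portfolio $\mathbf x(l-1)$) and put $\mu(x)=A^\top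 x+r$ and $\sigma^2(x)=\sum_{i,j}x_ix_j\sigma_i\sigma_j\rho_{ij}$. Assume that $\sigma^2(x)>0$ and that $1+x_j(e^{\mathcal Z_{k,j,\ell}}-1)>0$ a.s. for all $k,j,\ell$. Define $\mathcal Z^\star_{k,j,\ell}$ by $e^{\mathcal Z^\star_{k,j,\ell}}-1=x_j(e^{\mathcal Z_{k,j,\ell}}-1)$, write $M_{\mathcal Z^\star}(1)=\mathbb E e^{\mathcal Z^\star}$, and put $\mathfrak B_x(t)=\sigma^2(x)^{-1}\sum_jx_j\sigma_j\mathfrak B'_j(t)$. The log-return of period $t$ is $$\mathcal Y_t=\mu(x)-\tfrac12\sigma^2(x)+\sum_{j=1}^m\sum_{k=\mathcal N(t-1)+1}^{\mathcal N(t)}\mathcal Z^\star_{k,j,0}+\sum_{j=1}^m\sum_{k=\mathcal N_j(t-1)+1}^{\mathcal N_j(t)}\mathcal Z^\star_{k,j,1}+\sigma^2(x)\big(\mathfrak B_x(t)-\mathfrak B_x(t-1)\big).$$ Let $1\le l\le\tau$ be integers, let $w_{l-1}\in\mathbb R$ be the wealth at the beginning of period $l$, and let $\alpha_{l-1},\dots,\alpha_{\tau-1}\in\mathbb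 R$, not all zero. The terminal wealth is $$\mathcal W_\tau=w_{l-1}e^{\sum_{k=l}^\tau\mathcal Y_k}+\sum_{j=l}^{\tau-1}\alpha_je^{\sum_{k=j+1}^\tau\mathcal Y_k}.$$ Put $$V_n=\sigma^2(x)\big(\mathfrak B_x(\tau)-\mathfrak B_x(n)\big),\qquad \Lambda=\sigma^2(x)\sum_{k=l-1}^{\tau-1}\alpha_k\big(\mathfrak B_x(\tau)-\mathfrak B_x(k)\big),$$ $\sigma_\Lambda=\sqrt{\mathrm{Var}\,\Lambda}$, $r_n=\mathrm{corr}(V_n,\Lambda)$, and $$c_{1,n}=(\tau-n)r+\lambda(\tau-n)\Big(\prod_{j=1}^mM_{\mathcal Z^\star_{1,j,0}}(1)-1\Big)+(\tau-n)\sum_{j=1}^m\lambda_j\big(M_{\mathcal Z^\star_{1,j,1}}(1)-1\big),$$ $$c_{2,n}(x)=(\tau-n)A^\top x-\tfrac12(\tau-n)r_n^2\sigma^2(x),\qquad c_{3,n}=\sqrt{\tau-n}\;r_n .$$ *Conclusion.* 1. With $Q=\sum_{k,v=l-1}^{\tau-1}\alpha_k\alpha_v\min\{\tau-k,\tau-v\}$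 we have $\sigma_\Lambda^2=\sigma^2(x)\,Q>0$ and, for $l-1\le n\le\tau-1$, $r_n=\sum_{k=l-1}^{\tau-1}\alpha_k\min\{\tau-n,\tau-k\}\big/\sqrt{(\tau-n)Q}$. 2. $\mathcal W_\tau$ is integrable and, almost surely, $\mathbb E(\mathcal W_\tau\mid\Lambda)=\mathcal W_\tau^L$, where $$\mathcal W_\tau^L=w_{l-1}e^{c_{1,l-1}+c_{2,l-1}(x)+c_{3,l-1}\sqrt{\sigma^2(x)}\,\Lambda/\sigma_\Lambda}+\sum_{i=l}^{\tau-1}\alpha_ie^{c_{1,i}+c_{2,i}(x)+c_{3,i}\sqrt{\sigma^2(x)}\,\Lambda/\sigma_\Lambda}.$$ 3. $\mathcal W_\tau^L\le_{cx}\mathcal W_\tau$: both are integrable with the same mean, and $\mathbb E(\mathcal W_\tau^L-d)_+\le\mathbb E(\mathcal W_\tau-d)_+$ for all $d\in\mathbb R$. 4. If $w_{l-1}\ge0$ and $\alpha_k\ge0$ for all $l-1\le k\le\tau-1$, the vector of the conditional expectations given $\Lambda$ of the summands $w_{l-1}e^{\sum_{k=l}^\tau\mathcal Y_k}$ and $\alpha_je^{\sum_{k=j+1}^\tau\mathcal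 Y_k}$ ($l\le j\le\tau-1$) is comonotonic, that is, it has the law of $(f_i(Z))_i$ for one real random variable $Z$ and non-decreasing functions $f_i$. -/

import Mathlib

open MeasureTheory ProbabilityTheory
open scoped NNReal Matrix

namespace MertonPortfolio

noncomputable section

/-- A homogeneous Poisson process of intensity `lam` on `[0, ∞)`. -/
structure IsPoissonProcess {Ω : Type*} [MeasurableSpace Ω] (N : ℝ≥0 → Ω → ℕ) (lam : ℝ≥0)
    (P : Measure Ω) : Prop where
  measurable : ∀ t, Measurable (N t)
  zero : ∀ᵐ ω ∂P, N 0 ω = 0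
  monotone : ∀ᵐ ω ∂P, Monotone (fun t => N t ω)
  rightCont : ∀ᵐ ω ∂P, ∀ t, ContinuousWithinAt (fun s => N s ω) (Set.Ici t) t
  indepIncrements : HasIndepIncrements N P
  law : ∀ s t, s ≤ t → P.map (fun ω => N t ω - N s ω) = poissonMeasure (lam * (t - s))

/-- An `m`-dimensional family of standard Brownian motions, jointly Gaussian, with
`Cov(B i s, B j t) = ρ i j * min s t`. -/
structure IsCorrelatedBrownian {Ω : Type*} [MeasurableSpace Ω] {m : ℕ}
    (B : Fin m → ℝ≥0 → Ω → ℝ) (ρ : Matrix (Fin m) (Fin m) ℝ) (P : Measure Ω) : Prop where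
  measurable : ∀ j t, Measurable (B j t)
  brownian : ∀ j, IsBrownianReal (B j) P
  gaussian : IsGaussianProcess (fun p : Fin m × ℝ≥0 => B p.1 p.2) P
  covariance : ∀ i j s t, cov[B i s, B j t; P] = ρ i j * (min s t : ℝ≥0)

/-- The data of a market with one risk-free and `m` risky assets. -/
structure Market (m : ℕ) (Ω : Type*) where
  /-- risk-free interest rate -/
  r : ℝ
  /-- drifts of the risky assets -/
  drift : Fin m → ℝ
  /-- volatilities of the risky assets -/
  vol : Fin m → ℝ
  /-- correlations of the Brownian motions -/
  ρ : Matrix (Fin m) (Fin m) ℝ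
  /-- intensity of the common jumps -/
  lam : ℝ≥0
  /-- intensities of the individual jumps -/
  lamOwn : Fin m → ℝ≥0
  /-- driving Brownian motions -/
  B : Fin m → ℝ≥0 → Ω → ℝ
  /-- counting process of the common jumps -/
  N : ℝ≥0 → Ω → ℕ
  /-- counting processes of the individual jumps -/
  NOwn : Fin m → ℝ≥0 → Ω → ℕ
  /-- `Z k j 0` is the size, for asset `j`, of common jump number `k + 1`;
  `Z k j 1` is the size of individual jump number `k + 1` of asset `j` -/
  Z : ℕ → Fin m → Fin 2 → Ω → ℝ

/-- Labels of the sources of randomness. -/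
inductive Source (m : ℕ) : Type
  | brownian : Source m
  | common : Source m
  | own (j : Fin m) : Source m
  | jump (k : ℕ) (j : Fin m) (ℓ : Fin 2) : Source m

namespace Market

variable {m : ℕ} {Ω : Type*} (M : Market m Ω)

/-- The σ-algebra generated by a source of randomness. -/
@[reducible] def sigma : Source m → MeasurableSpace Ω
  | .brownian => ⨆ (j : Fin m) (t : ℝ≥0), MeasurableSpace.comap (M.B j t) inferInstance
  | .common => ⨆ t : ℝ≥0, MeasurableSpace.comap (M.N t) inferInstance
  | .own j => ⨆ t : ℝ≥0, MeasurableSpace.comap (M.NOwn j t) inferInstance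
  | .jump k j ℓ => MeasurableSpace.comap (M.Z k j ℓ) inferInstance

variable [MeasurableSpace Ω] (P : Measure Ω)

/-- The multivariate Merton model with dependent jumps: correlated Brownian motions, Poisson
clocks and jump sizes, all independent, the jump sizes of each kind being identically distributed
with finite exponential moment. -/
structure IsMerton : Prop where
  brownian : IsCorrelatedBrownian M.B M.ρ P
  common : IsPoissonProcess M.N M.lam P
  own : ∀ j, IsPoissonProcess (M.NOwn j) (M.lamOwn j) P
  measurable_jump : ∀ k j ℓ, Measurable (M.Z k j ℓ)
  identDistrib : ∀ k j ℓ, IdentDistrib (M.Z k j ℓ) (M.Z 0 j ℓ) P P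
  integrable_exp : ∀ j ℓ, Integrable (fun ω => Real.exp (M.Z 0 j ℓ ω)) P
  indep : iIndep M.sigma P

/-- Mean relative jump size `h_{j,ℓ}`. -/
def h (j : Fin m) (ℓ : Fin 2) : ℝ := ∫ ω, Real.exp (M.Z 0 j ℓ ω) ∂P - 1

/-- The drift vector of the prices. -/
def muVec (j : Fin m) : ℝ :=
  M.r + M.drift j - M.lam * M.h P j 0 - M.lamOwn j * M.h P j 1

/-- Excess drift vector `A = μ - r 1`. -/
def A (j : Fin m) : ℝ := M.muVec P j - M.r

/-- Portfolio drift `μ(x) = Aᵀ x + r`. -/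
def mu (x : Fin m → ℝ) : ℝ := M.A P ⬝ᵥ x + M.r

/-- Covariance matrix `Σ`. -/
def Sig : Matrix (Fin m) (Fin m) ℝ := Matrix.of fun i j => M.vol i * M.vol j * M.ρ i j

/-- Portfolio variance `σ²(x) = xᵀ Σ x`. -/
def sigmaSq (x : Fin m → ℝ) : ℝ := x ⬝ᵥ (M.Sig *ᵥ x)

/-- The portfolio's Brownian motion `B_x`, normalised by `1 / σ²(x)`. -/
def BX (x : Fin m → ℝ) (t : ℝ≥0) (ω : Ω) : ℝ :=
  (M.sigmaSq x)⁻¹ * ∑ j, x j * M.vol j * M.B j t ω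

/-- The portfolio's jump sizes `Z*`, the solution of `exp Z* - 1 = x_j (exp Z - 1)`. -/
def Zstar (x : Fin m → ℝ) (k : ℕ) (j : Fin m) (ℓ : Fin 2) (ω : Ω) : ℝ :=
  Real.log (1 + x j * (Real.exp (M.Z k j ℓ ω) - 1))

/-- `x` is admissible: no jump wipes out the portfolio, i.e. the equation defining `Z*` is
solvable almost surely. -/
def Admissible (x : Fin m → ℝ) : Prop :=
  ∀ k j ℓ, ∀ᵐ ω ∂P, 0 < 1 + x j * (Real.exp (M.Z k j ℓ ω) - 1)

/-- Log-return `Y_t(x)` over the period `(t - 1, t]`, for `t ≥ 1`. As jumps are numbered from `0`,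
those in `(t - 1, t]` have the numbers `N (t - 1), …, N t - 1`. -/
def Y (x : Fin m → ℝ) (t : ℕ) (ω : Ω) : ℝ :=
  M.mu P x - M.sigmaSq x / 2
    + ∑ j, ∑ k ∈ Finset.Ico (M.N ((t - 1 : ℕ) : ℝ≥0) ω) (M.N (t : ℝ≥0) ω), M.Zstar x k j 0 ω
    + ∑ j, ∑ k ∈ Finset.Ico (M.NOwn j ((t - 1 : ℕ) : ℝ≥0) ω) (M.NOwn j (t : ℝ≥0) ω),
        M.Zstar x k j 1 ω
    + M.sigmaSq x * (M.BX x (t : ℝ≥0) ω - M.BX x ((t - 1 : ℕ) : ℝ≥0) ω)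

/-- Value at time `τ` of a unit invested at time `n`. -/
def growth (x : Fin m → ℝ) (τ n : ℕ) (ω : Ω) : ℝ :=
  Real.exp (∑ k ∈ Finset.Ioc n τ, M.Y P x k ω)

/-- Terminal wealth, as seen at the beginning of period `l` with current wealth `w`. -/
def terminalWealth (x : Fin m → ℝ) (α : ℕ → ℝ) (w : ℝ) (l τ : ℕ) (ω : Ω) : ℝ :=
  w * M.growth P x τ (l - 1) ω + ∑ j ∈ Finset.Ico l τ, α j * M.growth P x τ j ω

/-- The Brownian part `V_n` of the log-return over `(n, τ]`. -/
def V (x : Fin m → ℝ) (τ n : ℕ) (ω : Ω) : ℝ :=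
  M.sigmaSq x * (M.BX x (τ : ℝ≥0) ω - M.BX x (n : ℝ≥0) ω)

/-- The conditioning variable `Λ`. -/
def Lam (x : Fin m → ℝ) (α : ℕ → ℝ) (l τ : ℕ) (ω : Ω) : ℝ :=
  M.sigmaSq x *
    ∑ k ∈ Finset.Ico (l - 1) τ, α k * (M.BX x (τ : ℝ≥0) ω - M.BX x (k : ℝ≥0) ω)

/-- The standard deviation of `Λ`. -/
def sdLam (x : Fin m → ℝ) (α : ℕ → ℝ) (l τ : ℕ) : ℝ := √(Var[M.Lam x α l τ; P])

end Market

/-- Pearson correlation. -/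
def corr {Ω : Type*} [MeasurableSpace Ω] (X Y : Ω → ℝ) (P : Measure Ω) : ℝ :=
  cov[X, Y; P] / (√(Var[X; P]) * √(Var[Y; P]))

/-- Convex order `X ≤_cx Y` of integrable random variables. -/
def ConvexOrder {Ω : Type*} [MeasurableSpace Ω] (X Y : Ω → ℝ) (P : Measure Ω) : Prop :=
  Integrable X P ∧ Integrable Y P ∧ ∫ ω, X ω ∂P = ∫ ω, Y ω ∂P ∧
    ∀ d : ℝ, ∫ ω, max (X ω - d) 0 ∂P ≤ ∫ ω, max (Y ω - d) 0 ∂P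

/-- A random vector is comonotonic if it has the law of `(f i z)_i` for non-decreasing `f i` and
a single real random variable `z`. -/
def IsComonotonic {Ω ι : Type*} [MeasurableSpace Ω] (X : ι → Ω → ℝ) (P : Measure Ω) : Prop :=
  ∃ ν : Measure ℝ, IsProbabilityMeasure ν ∧ ∃ f : ι → ℝ → ℝ, (∀ i, Monotone (f i)) ∧
    P.map (fun ω i => X i ω) = ν.map (fun z i => f i z)

/-- The quadratic form `∑_{k,v} α_k α_v min(τ - k, τ - v)`. -/
def quadForm (α : ℕ → ℝ) (l τ : ℕ) : ℝ :=
  ∑ k ∈ Finset.Ico (l - 1) τ, ∑ v ∈ Finset.Ico (l - 1) τ,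
    α k * α v * min ((τ : ℝ) - k) ((τ : ℝ) - v)

namespace Market

variable {m : ℕ} {Ω : Type*} (M : Market m Ω) [MeasurableSpace Ω] (P : Measure Ω)

/-- `r_n = corr(V_n, Λ)`. -/
def rCoef (x : Fin m → ℝ) (α : ℕ → ℝ) (l τ n : ℕ) : ℝ :=
  corr (M.V x τ n) (M.Lam x α l τ) P

/-- The constant `c_{1,n}`; `mgf X P 1` is the moment generating function at `1`. -/
def c₁ (x : Fin m → ℝ) (τ n : ℕ) : ℝ :=
  ((τ : ℝ) - n) * M.r
    + M.lam * ((τ : ℝ) - n) * ((∏ j, mgf (M.Zstar x 0 j 0) P 1) - 1)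
    + ((τ : ℝ) - n) * ∑ j, M.lamOwn j * (mgf (M.Zstar x 0 j 1) P 1 - 1)

/-- The constant `c_{2,n}(x)`. -/
def c₂ (x : Fin m → ℝ) (α : ℕ → ℝ) (l τ n : ℕ) : ℝ :=
  ((τ : ℝ) - n) * (M.A P ⬝ᵥ x)
    - 1 / 2 * ((τ : ℝ) - n) * M.rCoef P x α l τ n ^ 2 * M.sigmaSq x

/-- The constant `c_{3,n}`. -/
def c₃ (x : Fin m → ℝ) (α : ℕ → ℝ) (l τ n : ℕ) : ℝ :=
  √((τ : ℝ) - n) * M.rCoef P x α l τ n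

/-- The exponential `exp(c_{1,n} + c_{2,n}(x) + c_{3,n} √σ²(x) Λ / σ_Λ)`. -/
def lowerGrowth (x : Fin m → ℝ) (α : ℕ → ℝ) (l τ n : ℕ) (ω : Ω) : ℝ :=
  Real.exp (M.c₁ P x τ n + M.c₂ P x α l τ n
    + M.c₃ P x α l τ n * √(M.sigmaSq x) * (M.Lam x α l τ ω / M.sdLam P x α l τ))

/-- The explicit lower bound `W_τ^L`. -/
def lowerWealth (x : Fin m → ℝ) (α : ℕ → ℝ) (w : ℝ) (l τ : ℕ) (ω : Ω) : ℝ :=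
  w * M.lowerGrowth P x α l τ (l - 1) ω
    + ∑ i ∈ Finset.Ico l τ, α i * M.lowerGrowth P x α l τ i ω

/-- The σ-algebra generated by `Λ`. -/
@[reducible] def sigmaLam (x : Fin m → ℝ) (α : ℕ → ℝ) (l τ : ℕ) : MeasurableSpace Ω :=
  MeasurableSpace.comap (M.Lam x α l τ) inferInstance

/-- The part of terminal wealth that is invested at time `n`: current wealth for `n = l - 1`,
the endowment `α n` afterwards. -/
def contribution (x : Fin m → ℝ) (α : ℕ → ℝ) (w : ℝ) (l τ n : ℕ) (ω : Ω) : ℝ :=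
  (if n = l - 1 then w else α n) * M.growth P x τ n ω

end Market

end

end MertonPortfolio

/-!
Up to a null set, the growth factor over `(n, τ]` is a constant times `exp V_n` times a jump factor,
where `V_n` is the Brownian part of the log-return (`IsMerton.growth_ae_eq`). The jump factor is
built from the Poisson clocks and the jump sizes, hence is independent of the Brownian motions, so
in the conditional expectation given `Λ` it contributes only its mean (`condExp_mul_of_indep`).

The mean of the jump factor splits into one mean per clock, since different clocks and their jump
sizes form disjoint groups of independent sources. For one clock, freezing the counts turns the
product of a random number `K` of factors of mean `c` into `c ^ K`, and the generating function of
the Poisson law of `K` gives an exponential (`IsPoissonProcess.lintegral_prod`). Expectations are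
taken as Lebesgue integrals in `ℝ≥0∞`, so that integrability comes with the value.

The pair `(V_n, Λ)` is Gaussian and centred. `V_n` minus its linear regression on `Λ` is
uncorrelated with `Λ`, hence independent of it, and the moment generating function of this residual
gives the conditional expectation of `exp V_n` (`condExp_exp_of_hasGaussianLaw`). The variance and
the correlation come from `Cov(V_k, V_n) = σ²(x) min(τ - k, τ - n)`, as `Λ = ∑ α_k V_k`. The
quadratic form in `Var Λ` is the sum of the squares of the partial sums of `α`, which all vanish
only if `α` does (`quadForm_pos`).

The convex order is the conditional Jensen inequality for `y ↦ (y - d)₊`. If the `α_k` are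
nonnegative, then so are the correlations `r_n`; if the current wealth is nonnegative as well, the
conditional expectations are non-decreasing functions of the single random variable `Λ`.
-/

namespace MertonPortfolio

open scoped ENNReal

/-! ### Gaussian regression -/

lemma hasGaussianLaw_linearCombination_prodMk {Ω T : Type*} [MeasurableSpace Ω] {P : Measure Ω}
    {X : T → Ω → ℝ} (hX : IsGaussianProcess X P) (I : Finset T) (a b : T → ℝ) :
    HasGaussianLaw (fun ω => (∑ i ∈ I, a i * X i ω, ∑ i ∈ I, b i * X i ω)) P := by
  let L : (I → ℝ) →L[ℝ] ℝ × ℝ := ContinuousLinearMap.prod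
    (∑ i : I, a i • ContinuousLinearMap.proj i) (∑ i : I, b i • ContinuousLinearMap.proj i)
  have h := (hX.hasGaussianLaw I).map L
  have heq : (fun ω => (∑ i ∈ I, a i * X i ω, ∑ i ∈ I, b i * X i ω))
      = L ∘ fun ω => I.restrict (X · ω) := by
    funext ω
    simp [L, I.sum_attach fun i => a i * X i ω, I.sum_attach fun i => b i * X i ω]
  rwa [heq]

lemma integral_exp_of_hasGaussianLaw {Ω : Type*} [MeasurableSpace Ω] {P : Measure Ω} {X : Ω → ℝ}
    (hX : HasGaussianLaw X P) (h0 : P[X] = 0) :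
    ∫ ω, Real.exp (X ω) ∂P = Real.exp (Var[X; P] / 2) := by
  have h := mgf_gaussianReal hX.map_eq_gaussianReal 1
  simpa [mgf, h0, Real.coe_toNNReal _ (variance_nonneg X P)] using h

lemma integrable_exp_of_hasGaussianLaw {Ω : Type*} [MeasurableSpace Ω] {P : Measure Ω} {X : Ω → ℝ}
    (hX : HasGaussianLaw X P) : Integrable (fun ω => Real.exp (X ω)) P := by
  have h := mgf_gaussianReal hX.map_eq_gaussianReal 1
  -- a nonzero integral is not the default value of a non-integrable function
  refine not_imp_comm.1 integral_undef (ne_of_gt ?_)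
  have : mgf X P 1 = ∫ ω, Real.exp (X ω) ∂P := by simp [mgf]
  rw [← this, h]
  exact Real.exp_pos _

/-- For a centred Gaussian pair, `X` is its regression on `L` plus an independent Gaussian
residual of variance `Var X * (1 - corr ^ 2)`. -/
lemma condExp_exp_of_hasGaussianLaw {Ω : Type*} [mΩ : MeasurableSpace Ω] {P : Measure Ω}
    [IsProbabilityMeasure P] {X L : Ω → ℝ} (hL : Measurable L)
    (h : HasGaussianLaw (fun ω => (X ω, L ω)) P) (hX0 : P[X] = 0) (hL0 : P[L] = 0)
    (hXv : 0 < Var[X; P]) (hLv : 0 < Var[L; P]) :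
    P[fun ω => Real.exp (X ω) | MeasurableSpace.comap L inferInstance] =ᵐ[P] fun ω =>
      Real.exp (√(Var[X; P]) * corr X L P * (L ω / √(Var[L; P]))
        + Var[X; P] * (1 - corr X L P ^ 2) / 2) := by
  have gX : HasGaussianLaw X P := h.fst
  have gL : HasGaussianLaw L P := h.snd
  have hle : MeasurableSpace.comap L inferInstance ≤ mΩ := hL.comap_le
  set b := cov[X, L; P] / Var[L; P] with hb
  set R : Ω → ℝ := fun ω => X ω - b * L ω with hR
  have hRL : HasGaussianLaw (fun ω => (R ω, L ω)) P :=
    h.map ((ContinuousLinearMap.fst ℝ ℝ ℝ - b • ContinuousLinearMap.snd ℝ ℝ ℝ).prod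
      (ContinuousLinearMap.snd ℝ ℝ ℝ))
  have gR : HasGaussianLaw R P := hRL.fst
  have hbL : MemLp (fun ω => b * L ω) 2 P := gL.memLp_two.const_mul b
  have hcov : cov[R, L; P] = 0 := by
    rw [hR, covariance_fun_sub_left gX.memLp_two hbL gL.memLp_two, covariance_const_mul_left,
      covariance_self gL.aemeasurable, hb]
    field_simp
    ring
  have hind : IndepFun R L P := hRL.indepFun_of_covariance_eq_zero hcov
  have hR0 : P[R] = 0 := by
    rw [hR, integral_sub gX.integrable (gL.integrable.const_mul b), integral_const_mul, hX0, hL0]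
    simp
  have hRv : Var[R; P] = Var[X; P] * (1 - corr X L P ^ 2) := by
    rw [hR, variance_fun_sub gX.memLp_two hbL, covariance_const_mul_right, variance_const_mul,
      corr, div_pow cov[X, L; P] (_ * _), mul_pow, Real.sq_sqrt hXv.le, Real.sq_sqrt hLv.le, hb]
    field_simp
    ring
  have hsplit : (fun ω => Real.exp (X ω))
      = (fun ω => Real.exp (b * L ω)) * fun ω => Real.exp (R ω) := by
    funext ω
    simp only [Pi.mul_apply, hR, ← Real.exp_add]
    congr 1
    ring
  have hLmeas : Measurable[MeasurableSpace.comap L inferInstance] L := comap_measurable L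
  have hmul := condExp_mul_of_stronglyMeasurable_left
    (μ := P) (m := MeasurableSpace.comap L inferInstance)
    (f := fun ω => Real.exp (b * L ω)) (g := fun ω => Real.exp (R ω))
    (Measurable.stronglyMeasurable (by fun_prop))
    (hsplit ▸ integrable_exp_of_hasGaussianLaw gX) (integrable_exp_of_hasGaussianLaw gR)
  have hcond : P[fun ω => Real.exp (R ω) | MeasurableSpace.comap L inferInstance]
      =ᵐ[P] fun _ => Real.exp (Var[R; P] / 2) := by
    -- the independence lemma asks for a measurable residual, so a version is used
    obtain ⟨R', hR', hRR'⟩ := gR.aemeasurable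
    have hind' : IndepFun R' L P := hind.congr hRR' Filter.EventuallyEq.rfl
    have hexp : (fun ω => Real.exp (R ω)) =ᵐ[P] fun ω => Real.exp (R' ω) := by
      filter_upwards [hRR'] with ω hω
      rw [hω]
    refine (condExp_congr_ae hexp).trans ?_
    have := condExp_indep_eq (m₁ := MeasurableSpace.comap R' inferInstance)
      (f := fun ω => Real.exp (R' ω)) (μ := P) hR'.comap_le hle
      (Measurable.stronglyMeasurable (Real.measurable_exp.comp (comap_measurable R')))
      ((IndepFun_iff_Indep _ _ _).1 hind')
    rwa [← integral_congr_ae hexp, integral_exp_of_hasGaussianLaw gR hR0] at this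
  rw [hsplit]
  filter_upwards [hmul, hcond] with ω h1 h2
  rw [h1, Pi.mul_apply, h2, ← Real.exp_add, hRv]
  congr 2
  have e1 : √(Var[X; P]) ≠ 0 := (Real.sqrt_pos.2 hXv).ne'
  have e2 : √(Var[L; P]) ≠ 0 := (Real.sqrt_pos.2 hLv).ne'
  have e3 : √(Var[L; P]) * √(Var[L; P]) = Var[L; P] := Real.mul_self_sqrt hLv.le
  have e4 : b = cov[X, L; P] / (√(Var[L; P]) * √(Var[L; P])) := by rw [e3]
  rw [e4, corr]
  field_simp

/-- A factor independent of a `σ`-algebra containing all the others only contributes its mean. -/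
lemma condExp_mul_of_indep {Ω : Type*} {m₁ m₂ m mΩ : MeasurableSpace Ω} {P : Measure Ω}
    [IsProbabilityMeasure P] (h₁ : m₁ ≤ mΩ) (h₂ : m₂ ≤ mΩ) (hm : m ≤ m₂) (hind : Indep m₁ m₂ P)
    {J Y : Ω → ℝ} (hJ : Measurable[m₁] J) (hY : Measurable[m₂] Y)
    (hJi : Integrable J P) (hYi : Integrable Y P) :
    Integrable (Y * J) P ∧ P[Y * J | m] =ᵐ[P] fun ω => (∫ ω', J ω' ∂P) * P[Y | m] ω := by
  have hindf : IndepFun Y J P := by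
    rw [IndepFun_iff_Indep]
    exact indep_of_indep_of_le_left (indep_of_indep_of_le_right hind.symm hJ.comap_le)
      hY.comap_le
  have hint : Integrable (Y * J) P := hindf.integrable_mul hYi hJi
  refine ⟨hint, ?_⟩
  have h1 : P[Y * J | m₂] =ᵐ[P] (∫ ω', J ω' ∂P) • Y := by
    filter_upwards [condExp_mul_of_stronglyMeasurable_left hY.stronglyMeasurable hint hJi,
      condExp_indep_eq h₁ h₂ hJ.stronglyMeasurable hind] with ω e1 e2
    rw [e1, Pi.mul_apply, e2, Pi.smul_apply, smul_eq_mul, mul_comm]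
  refine (condExp_condExp_of_le hm h₂).symm.trans ((condExp_congr_ae h1).trans ?_)
  exact condExp_smul _ _ _

/-! ### Compound Poisson products -/

/-- Variables that depend on pairwise disjoint groups of independent sources have multiplicative
expectations. -/
lemma lintegral_prod_eq_prod_lintegral_of_iIndep {Ω ι κ : Type*} {mΩ : MeasurableSpace Ω}
    {P : Measure Ω} {m : ι → MeasurableSpace Ω} (hle : ∀ i, m i ≤ mΩ) (hind : iIndep m P)
    {S : κ → Set ι} (hS : Pairwise fun a b => Disjoint (S a) (S b)) {f : κ → Ω → ℝ≥0∞}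
    (hf : ∀ a, Measurable[⨆ i ∈ S a, m i] (f a)) (s : Finset κ) :
    ∫⁻ ω, ∏ a ∈ s, f a ω ∂P = ∏ a ∈ s, ∫⁻ ω, f a ω ∂P := by
  classical
  have : IsProbabilityMeasure P := hind.isProbabilityMeasure
  induction s using Finset.induction_on with
  | empty => simp
  | insert a s ha ih =>
    have hdisj : Disjoint (S a) (⋃ b ∈ s, S b) := by
      simp only [Set.disjoint_iUnion_right]
      intro b hb
      exact hS fun hab => ha (hab ▸ hb)
    have hmeas : Measurable[⨆ i ∈ ⋃ b ∈ s, S b, m i] fun ω => ∏ b ∈ s, f b ω := by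
      refine Finset.measurable_fun_prod s fun b hb => (hf b).mono ?_ le_rfl
      exact biSup_mono fun i hi => Set.mem_biUnion hb hi
    simp only [Finset.prod_insert ha, ← ih]
    exact lintegral_mul_eq_lintegral_mul_lintegral_of_independent_measurableSpace
      (iSup₂_le fun i _ => hle i) (iSup₂_le fun i _ => hle i)
      (indep_iSup_of_disjoint hle hind hdisj) (hf a) hmeas

/-- A function of the pair `(n₁, n₂)` of counts and of the outcome is measurable once it is so for
each value of the counts. -/
lemma measurable_of_counts {Ω β : Type*} {m : MeasurableSpace Ω} [MeasurableSpace β]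
    {f : ℕ → ℕ → Ω → β} (hf : ∀ a b, Measurable (f a b)) {N₁ N₂ : Ω → ℕ}
    (h₁ : Measurable N₁) (h₂ : Measurable N₂) : Measurable fun ω => f (N₁ ω) (N₂ ω) ω := by
  have h : Measurable fun p : (ℕ × ℕ) × Ω => f p.1.1 p.1.2 p.2 :=
    measurable_from_prod_countable_right fun p => hf p.1 p.2
  exact h.comp ((h₁.prodMk h₂).prodMk measurable_id)

/-- Expectation of a product of randomly many factors, when the number of factors is independent
of the factors. -/
lemma lintegral_random_prod {Ω : Type*} {m₁ m₂ mΩ : MeasurableSpace Ω} {P : Measure Ω}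
    (h₁ : m₁ ≤ mΩ) (h₂ : m₂ ≤ mΩ) (hind : Indep m₁ m₂ P) {N₁ N₂ : Ω → ℕ}
    (hN₁ : Measurable[m₁] N₁) (hN₂ : Measurable[m₁] N₂) {X : ℕ → Ω → ℝ≥0∞}
    (hX : ∀ k, Measurable[m₂] (X k)) {c : ℝ≥0∞}
    (hc : ∀ a b, ∫⁻ ω, ∏ k ∈ Finset.Ico a b, X k ω ∂P = c ^ (b - a)) :
    ∫⁻ ω, ∏ k ∈ Finset.Ico (N₁ ω) (N₂ ω), X k ω ∂P = ∫⁻ ω, c ^ (N₂ ω - N₁ ω) ∂P := by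
  -- both sides are split according to the values of the counts
  set I : ℕ × ℕ → Ω → ℝ≥0∞ := fun p ω => if (N₁ ω, N₂ ω) = p then 1 else 0 with hI
  have hImeas : ∀ p, Measurable[m₁] (I p) := fun p =>
    measurable_of_counts (m := m₁) (f := fun a b _ => if (a, b) = p then 1 else 0)
      (fun _ _ => measurable_const) hN₁ hN₂
  have key : ∀ (F : ℕ → ℕ → Ω → ℝ≥0∞) ω, F (N₁ ω) (N₂ ω) ω = ∑' p, I p ω * F p.1 p.2 ω := by
    intro F ω
    rw [tsum_eq_single (N₁ ω, N₂ ω)]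
    · simp [hI]
    · intro p hp
      simp [hI, hp.symm]
  have hprod : ∀ a b, Measurable[m₂] fun ω => ∏ k ∈ Finset.Ico a b, X k ω := fun a b =>
    Finset.measurable_fun_prod _ fun k _ => hX k
  have hImeas' : ∀ p, Measurable (I p) := fun p => (hImeas p).mono h₁ le_rfl
  calc ∫⁻ ω, ∏ k ∈ Finset.Ico (N₁ ω) (N₂ ω), X k ω ∂P
      = ∫⁻ ω, ∑' p, I p ω * ∏ k ∈ Finset.Ico p.1 p.2, X k ω ∂P :=
        lintegral_congr fun ω => key (fun a b ω => ∏ k ∈ Finset.Ico a b, X k ω) ω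
    _ = ∑' p, ∫⁻ ω, I p ω * ∏ k ∈ Finset.Ico p.1 p.2, X k ω ∂P :=
        lintegral_tsum fun p =>
          ((hImeas' p).mul ((hprod p.1 p.2).mono h₂ le_rfl)).aemeasurable
    _ = ∑' p, ∫⁻ ω, I p ω * c ^ (p.2 - p.1) ∂P := by
        congr 1
        funext p
        rw [lintegral_mul_eq_lintegral_mul_lintegral_of_independent_measurableSpace h₁ h₂ hind
          (hImeas p) (hprod p.1 p.2), hc, lintegral_mul_const _ (hImeas' p)]
    _ = ∫⁻ ω, ∑' p, I p ω * c ^ (p.2 - p.1) ∂P :=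
        (lintegral_tsum fun p => ((hImeas' p).mul_const _).aemeasurable).symm
    _ = ∫⁻ ω, c ^ (N₂ ω - N₁ ω) ∂P :=
        (lintegral_congr fun ω => key (fun a b _ => c ^ (b - a)) ω).symm

lemma lintegral_pow_poissonMeasure (r : ℝ≥0) {c : ℝ} (hc : 0 ≤ c) :
    ∫⁻ n, ENNReal.ofReal c ^ n ∂(poissonMeasure r) = ENNReal.ofReal (Real.exp (r * (c - 1))) := by
  have hs : HasSum (fun n : ℕ => Real.exp (-r) * r ^ n / n.factorial * c ^ n)
      (Real.exp (r * (c - 1))) := by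
    have h := (NormedSpace.expSeries_div_hasSum_exp (r * c : ℝ)).mul_left (Real.exp (-r))
    convert! h using 1
    · funext n
      rw [mul_pow]
      ring
    · rw [← Real.exp_eq_exp_ℝ, ← Real.exp_add]
      congr 1
      ring
  have hnn : ∀ n : ℕ, 0 ≤ Real.exp (-r) * r ^ n / n.factorial * c ^ n := fun n => by positivity
  rw [poissonMeasure, lintegral_sum_measure, ← hs.tsum_eq,
    ENNReal.ofReal_tsum_of_nonneg hnn hs.summable]
  congr 1
  funext n
  rw [lintegral_smul_measure, lintegral_dirac, smul_eq_mul, ENNReal.ofReal_mul (by positivity),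
    ENNReal.ofReal_pow hc]

/-- Expectation of a compound Poisson product over the window `(s, t]`. -/
lemma IsPoissonProcess.lintegral_prod {Ω : Type*} {m₁ m₂ mΩ : MeasurableSpace Ω} {P : Measure Ω}
    {N : ℝ≥0 → Ω → ℕ} {lam : ℝ≥0} (hN : IsPoissonProcess N lam P)
    (h₁ : m₁ ≤ mΩ) (h₂ : m₂ ≤ mΩ) (hind : Indep m₁ m₂ P)
    (hNm : ∀ t, Measurable[m₁] (N t)) {X : ℕ → Ω → ℝ≥0∞} (hX : ∀ k, Measurable[m₂] (X k))
    {c : ℝ} (hc0 : 0 ≤ c)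
    (hc : ∀ a b, ∫⁻ ω, ∏ k ∈ Finset.Ico a b, X k ω ∂P = ENNReal.ofReal c ^ (b - a))
    {s t : ℝ≥0} (hst : s ≤ t) :
    ∫⁻ ω, ∏ k ∈ Finset.Ico (N s ω) (N t ω), X k ω ∂P
      = ENNReal.ofReal (Real.exp (lam * ((t : ℝ) - s) * (c - 1))) := by
  rw [lintegral_random_prod h₁ h₂ hind (hNm s) (hNm t) hX hc]
  have hmap := lintegral_map (μ := P) (f := fun n : ℕ => ENNReal.ofReal c ^ n)
    (g := fun ω => N t ω - N s ω) Measurable.of_discrete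
    (measurable_of_counts (f := fun a b _ => b - a) (fun _ _ => measurable_const)
      (hN.measurable s) (hN.measurable t))
  rw [← hmap, hN.law s t hst, lintegral_pow_poissonMeasure _ hc0]
  push_cast [NNReal.coe_sub hst]
  rfl

namespace Market

/-! ### The Brownian part of the log-returns -/

variable {m : ℕ} {Ω : Type*} (M : Market m Ω)

lemma V_eq {x : Fin m → ℝ} (hσ : M.sigmaSq x ≠ 0) (τ n : ℕ) (ω : Ω) :
    M.V x τ n ω = ∑ j, x j * M.vol j * (M.B j τ ω - M.B j n ω) := by
  simp only [V, BX, mul_sub, Finset.sum_sub_distrib]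
  rw [mul_inv_cancel_left₀ hσ, mul_inv_cancel_left₀ hσ]

lemma Lam_eq (x : Fin m → ℝ) (α : ℕ → ℝ) (l τ : ℕ) (ω : Ω) :
    M.Lam x α l τ ω = ∑ k ∈ Finset.Ico (l - 1) τ, α k * M.V x τ k ω := by
  simp only [Lam, V, Finset.mul_sum]
  exact Finset.sum_congr rfl fun k _ => by ring

lemma measurable_B_sigma (j : Fin m) (t : ℝ≥0) : Measurable[M.sigma .brownian] (M.B j t) :=
  measurable_iff_comap_le.2
    (le_iSup₂ (f := fun (j : Fin m) (t : ℝ≥0) => MeasurableSpace.comap (M.B j t) inferInstance)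
      j t)

lemma measurable_V_sigma (x : Fin m → ℝ) (τ n : ℕ) :
    Measurable[M.sigma .brownian] (M.V x τ n) := by
  have h := M.measurable_B_sigma
  unfold V BX
  fun_prop

lemma measurable_Lam_sigma (x : Fin m → ℝ) (α : ℕ → ℝ) (l τ : ℕ) :
    Measurable[M.sigma .brownian] (M.Lam x α l τ) := by
  have h := M.measurable_B_sigma
  unfold Lam BX
  fun_prop

variable {M} [MeasurableSpace Ω] {P : Measure Ω}

lemma IsMerton.sigma_le (hM : M.IsMerton P) : ∀ i, M.sigma i ≤ ‹MeasurableSpace Ω›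
  | .brownian => iSup₂_le fun j t => (hM.brownian.measurable j t).comap_le
  | .common => iSup_le fun t => (hM.common.measurable t).comap_le
  | .own j => iSup_le fun t => ((hM.own j).measurable t).comap_le
  | .jump k j ℓ => (hM.measurable_jump k j ℓ).comap_le

lemma IsMerton.isGaussianProcess_V (hM : M.IsMerton P) {x : Fin m → ℝ}
    (hσ : M.sigmaSq x ≠ 0) (τ : ℕ) : IsGaussianProcess (fun n => M.V x τ n) P := by
  classical
  refine hM.brownian.gaussian.of_isGaussianProcess fun n => ?_
  have hmem : ∀ j : Fin m, ∀ t ∈ ({(τ : ℝ≥0), (n : ℝ≥0)} : Finset ℝ≥0),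
      (j, t) ∈ Finset.univ ×ˢ ({(τ : ℝ≥0), (n : ℝ≥0)} : Finset ℝ≥0) := by simp
  refine ⟨Finset.univ ×ˢ {(τ : ℝ≥0), (n : ℝ≥0)},
    ∑ j, (x j * M.vol j) • (ContinuousLinearMap.proj ⟨(j, τ), hmem j _ (by simp)⟩
      - ContinuousLinearMap.proj ⟨(j, n), hmem j _ (by simp)⟩), fun ω => ?_⟩
  simp [M.V_eq hσ]

lemma IsMerton.integral_V (hM : M.IsMerton P) {x : Fin m → ℝ}
    (hσ : M.sigmaSq x ≠ 0) (τ n : ℕ) : ∫ ω, M.V x τ n ω ∂P = 0 := by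
  have hi : ∀ j t, Integrable (M.B j t) P := fun j t =>
    (hM.brownian.brownian j).toIsPreBrownianReal.integrable_eval t
  have h0 : ∀ j t, ∫ ω, M.B j t ω ∂P = 0 := fun j t =>
    (hM.brownian.brownian j).toIsPreBrownianReal.integral_eval t
  simp only [M.V_eq hσ]
  have hinc : ∀ j, Integrable (fun ω => x j * M.vol j * (M.B j τ ω - M.B j n ω)) P := fun j =>
    ((hi j _).sub (hi j _)).const_mul _
  rw [integral_finsetSum _ fun j _ => hinc j]
  refine Finset.sum_eq_zero fun j _ => ?_
  rw [integral_const_mul, integral_sub (hi j _) (hi j _), h0, h0]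
  simp

lemma IsMerton.covariance_V (hM : M.IsMerton P) {x : Fin m → ℝ} (hσ : M.sigmaSq x ≠ 0)
    {τ k n : ℕ} (hk : k ≤ τ) (hn : n ≤ τ) :
    cov[M.V x τ k, M.V x τ n; P] = M.sigmaSq x * min ((τ : ℝ) - k) ((τ : ℝ) - n) := by
  have : IsProbabilityMeasure P := hM.brownian.gaussian.isProbabilityMeasure
  have hB : ∀ j t, MemLp (M.B j t) 2 P := fun j t =>
    (hM.brownian.gaussian.hasGaussianLaw_eval (j, t)).memLp_two
  have hinc : ∀ j (s t : ℝ≥0), MemLp (fun ω => M.B j s ω - M.B j t ω) 2 P := fun j s t =>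
    (hB j s).sub (hB j t)
  have hcov : ∀ i j, cov[fun ω => M.B i τ ω - M.B i k ω, fun ω => M.B j τ ω - M.B j n ω; P]
      = M.ρ i j * min ((τ : ℝ) - k) ((τ : ℝ) - n) := by
    intro i j
    rw [covariance_fun_sub_fun_sub (hB i _) (hB i _) (hB j _) (hB j _)]
    simp only [hM.brownian.covariance]
    have hk' : (k : ℝ≥0) ≤ τ := by exact_mod_cast hk
    have hn' : (n : ℝ≥0) ≤ τ := by exact_mod_cast hn
    rw [min_self, min_eq_right hn', min_eq_left hk']
    push_cast
    rw [min_sub_sub_left]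
    have := min_add_max (k : ℝ) n
    linear_combination (M.ρ i j) * this
  have hV : ∀ n, M.V x τ n
      = fun ω => ∑ j, x j * M.vol j * (M.B j τ ω - M.B j n ω) := fun n => funext (M.V_eq hσ τ n)
  rw [hV, hV, covariance_fun_sum_fun_sum (fun j => (hinc j _ _).const_mul _)
    (fun j => (hinc j _ _).const_mul _)]
  simp only [covariance_const_mul_left, covariance_const_mul_right, hcov, sigmaSq, Sig,
    dotProduct, Matrix.mulVec, Matrix.of_apply, Finset.sum_mul, Finset.mul_sum]
  exact Finset.sum_congr rfl fun i _ => Finset.sum_congr rfl fun j _ => by ring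

lemma IsMerton.hasGaussianLaw_V_Lam (hM : M.IsMerton P) {x : Fin m → ℝ}
    (hσ : M.sigmaSq x ≠ 0) (α : ℕ → ℝ) {l τ n : ℕ} (hn : n ∈ Finset.Ico (l - 1) τ) :
    HasGaussianLaw (fun ω => (M.V x τ n ω, M.Lam x α l τ ω)) P := by
  convert! hasGaussianLaw_linearCombination_prodMk (hM.isGaussianProcess_V hσ τ)
    (Finset.Ico (l - 1) τ) (fun k => if k = n then 1 else 0) α using 3 with ω
  · simp [ite_mul, Finset.mem_Ico.1 hn]
  · exact M.Lam_eq x α l τ ω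

lemma IsMerton.memLp_V (hM : M.IsMerton P) {x : Fin m → ℝ}
    (hσ : M.sigmaSq x ≠ 0) (τ n : ℕ) : MemLp (M.V x τ n) 2 P :=
  ((hM.isGaussianProcess_V hσ τ).hasGaussianLaw_eval n).memLp_two

lemma IsMerton.covariance_V_Lam (hM : M.IsMerton P) {x : Fin m → ℝ}
    (hσ : M.sigmaSq x ≠ 0) (α : ℕ → ℝ) {l τ n : ℕ} (hn : n ≤ τ) :
    cov[M.V x τ n, M.Lam x α l τ; P] = M.sigmaSq x *
      ∑ k ∈ Finset.Ico (l - 1) τ, α k * min ((τ : ℝ) - n) ((τ : ℝ) - k) := by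
  have : IsProbabilityMeasure P := hM.brownian.gaussian.isProbabilityMeasure
  have hL : M.Lam x α l τ = fun ω => ∑ k ∈ Finset.Ico (l - 1) τ, α k * M.V x τ k ω :=
    funext (M.Lam_eq x α l τ)
  rw [hL, covariance_fun_sum_right' (fun k _ => (hM.memLp_V hσ τ k).const_mul (α k))
    (hM.memLp_V hσ τ n), Finset.mul_sum]
  refine Finset.sum_congr rfl fun k hk => ?_
  rw [covariance_const_mul_right, hM.covariance_V hσ hn (Finset.mem_Ico.1 hk).2.le]
  ring

lemma IsMerton.memLp_Lam (hM : M.IsMerton P) {x : Fin m → ℝ}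
    (hσ : M.sigmaSq x ≠ 0) (α : ℕ → ℝ) (l τ : ℕ) : MemLp (M.Lam x α l τ) 2 P := by
  have hL : M.Lam x α l τ = fun ω => ∑ k ∈ Finset.Ico (l - 1) τ, α k * M.V x τ k ω :=
    funext (M.Lam_eq x α l τ)
  rw [hL]
  exact memLp_finsetSum _ fun k _ => (hM.memLp_V hσ τ k).const_mul (α k)

lemma IsMerton.integral_Lam (hM : M.IsMerton P) {x : Fin m → ℝ}
    (hσ : M.sigmaSq x ≠ 0) (α : ℕ → ℝ) (l τ : ℕ) : ∫ ω, M.Lam x α l τ ω ∂P = 0 := by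
  have : IsProbabilityMeasure P := hM.brownian.gaussian.isProbabilityMeasure
  simp only [M.Lam_eq]
  rw [integral_finsetSum _ fun k _ =>
    ((hM.memLp_V hσ τ k).integrable one_le_two).const_mul (α k)]
  exact Finset.sum_eq_zero fun k _ => by rw [integral_const_mul, hM.integral_V hσ, mul_zero]

lemma IsMerton.variance_V (hM : M.IsMerton P) {x : Fin m → ℝ}
    (hσ : M.sigmaSq x ≠ 0) {τ n : ℕ} (hn : n ≤ τ) :
    Var[M.V x τ n; P] = M.sigmaSq x * ((τ : ℝ) - n) := by
  rw [← covariance_self (hM.memLp_V hσ τ n).aemeasurable, hM.covariance_V hσ hn hn, min_self]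

lemma IsMerton.variance_Lam (hM : M.IsMerton P) {x : Fin m → ℝ}
    (hσ : M.sigmaSq x ≠ 0) (α : ℕ → ℝ) (l τ : ℕ) :
    Var[M.Lam x α l τ; P] = M.sigmaSq x * quadForm α l τ := by
  have : IsProbabilityMeasure P := hM.brownian.gaussian.isProbabilityMeasure
  have hL : M.Lam x α l τ = fun ω => ∑ k ∈ Finset.Ico (l - 1) τ, α k * M.V x τ k ω :=
    funext (M.Lam_eq x α l τ)
  rw [← covariance_self (hM.memLp_Lam hσ α l τ).aemeasurable]
  nth_rewrite 1 [hL]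
  rw [covariance_fun_sum_left' (fun k _ => (hM.memLp_V hσ τ k).const_mul (α k))
    (hM.memLp_Lam hσ α l τ), quadForm, Finset.mul_sum]
  refine Finset.sum_congr rfl fun k hk => ?_
  rw [covariance_const_mul_left, hM.covariance_V_Lam hσ α (Finset.mem_Ico.1 hk).2.le,
    Finset.mul_sum, Finset.mul_sum, Finset.mul_sum]
  exact Finset.sum_congr rfl fun v _ => by ring

end Market

/-- The quadratic form is the sum of the squares of the partial sums of `α`. -/
lemma quadForm_eq_sum_sq (α : ℕ → ℝ) (l τ : ℕ) :
    quadForm α l τ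
      = ∑ t ∈ Finset.Ico (l - 1) τ, (∑ k ∈ Finset.Ico (l - 1) (t + 1), α k) ^ 2 := by
  -- `min (τ - k) (τ - v)` counts the `t < τ` that lie above both `k` and `v`
  have hmin : ∀ k ∈ Finset.Ico (l - 1) τ, ∀ v ∈ Finset.Ico (l - 1) τ,
      min ((τ : ℝ) - k) ((τ : ℝ) - v)
        = ∑ t ∈ Finset.Ico (l - 1) τ, (if k ≤ t then 1 else 0) * (if v ≤ t then (1 : ℝ) else 0) := by
    intro k hk v hv
    simp only [Finset.mem_Ico] at hk hv
    have hfilter : (Finset.Ico (l - 1) τ).filter (fun t => k ≤ t ∧ v ≤ t)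
        = Finset.Ico (max k v) τ := by
      ext t
      simp only [Finset.mem_filter, Finset.mem_Ico, max_le_iff]
      omega
    have hite : ∀ t : ℕ, (if k ≤ t then 1 else 0) * (if v ≤ t then (1 : ℝ) else 0)
        = if k ≤ t ∧ v ≤ t then 1 else 0 := by
      intro t
      by_cases h₁ : k ≤ t <;> by_cases h₂ : v ≤ t <;> simp [h₁, h₂]
    rw [Finset.sum_congr rfl fun t _ => hite t, Finset.sum_boole, hfilter, Nat.card_Ico,
      Nat.cast_sub (max_le hk.2.le hv.2.le), Nat.cast_max, min_sub_sub_left]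
  have hpart : ∀ t ∈ Finset.Ico (l - 1) τ, ∑ k ∈ Finset.Ico (l - 1) (t + 1), α k
      = ∑ k ∈ Finset.Ico (l - 1) τ, α k * if k ≤ t then 1 else 0 := by
    intro t ht
    simp only [Finset.mem_Ico] at ht
    simp only [mul_ite, mul_one, mul_zero]
    rw [← Finset.sum_filter]
    congr 1
    ext k
    simp only [Finset.mem_filter, Finset.mem_Ico]
    omega
  calc quadForm α l τ
      = ∑ k ∈ Finset.Ico (l - 1) τ, ∑ v ∈ Finset.Ico (l - 1) τ, ∑ t ∈ Finset.Ico (l - 1) τ,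
          (α k * if k ≤ t then 1 else 0) * (α v * if v ≤ t then 1 else 0) := by
        refine Finset.sum_congr rfl fun k hk => Finset.sum_congr rfl fun v hv => ?_
        rw [hmin k hk v hv, Finset.mul_sum]
        exact Finset.sum_congr rfl fun t _ => by ring
    _ = ∑ t ∈ Finset.Ico (l - 1) τ, ∑ k ∈ Finset.Ico (l - 1) τ, ∑ v ∈ Finset.Ico (l - 1) τ,
          (α k * if k ≤ t then 1 else 0) * (α v * if v ≤ t then 1 else 0) :=
        (Finset.sum_comm.trans (Finset.sum_congr rfl fun k _ => Finset.sum_comm)).symm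
    _ = _ := by
        refine Finset.sum_congr rfl fun t ht => ?_
        rw [hpart t ht, sq, Finset.sum_mul_sum]

lemma quadForm_pos {α : ℕ → ℝ} {l τ : ℕ} (hα : ∃ k ∈ Finset.Ico (l - 1) τ, α k ≠ 0) :
    0 < quadForm α l τ := by
  rw [quadForm_eq_sum_sq]
  refine (Finset.sum_nonneg fun t _ => sq_nonneg _).lt_of_ne' fun h0 => ?_
  rw [Finset.sum_eq_zero_iff_of_nonneg fun t _ => sq_nonneg _] at h0
  obtain ⟨k, hk, hne⟩ := hα
  rw [Finset.mem_Ico] at hk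
  apply hne
  -- a coefficient is the difference of two consecutive partial sums
  have h1 := pow_eq_zero_iff two_ne_zero |>.1 (h0 k (Finset.mem_Ico.2 hk))
  rw [Finset.sum_Ico_succ_top hk.1] at h1
  rcases hk.1.eq_or_lt with he | hlt
  · simpa [he] using h1
  · obtain ⟨j, rfl⟩ : ∃ j, k = j + 1 := ⟨k - 1, by omega⟩
    have h2 := pow_eq_zero_iff two_ne_zero |>.1 (h0 j (Finset.mem_Ico.2 ⟨by omega, by omega⟩))
    rw [h2] at h1
    simpa using h1

namespace Market

variable {m : ℕ} {Ω : Type*} {M : Market m Ω} [MeasurableSpace Ω] {P : Measure Ω}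

lemma IsMerton.rCoef_eq (hM : M.IsMerton P) {x : Fin m → ℝ} (hσ : 0 < M.sigmaSq x)
    (α : ℕ → ℝ) {l τ n : ℕ} (hn : n ≤ τ) :
    M.rCoef P x α l τ n =
      (∑ k ∈ Finset.Ico (l - 1) τ, α k * min ((τ : ℝ) - n) ((τ : ℝ) - k)) /
        √(((τ : ℝ) - n) * quadForm α l τ) := by
  have hn' : (0 : ℝ) ≤ (τ : ℝ) - n := sub_nonneg.2 (by exact_mod_cast hn)
  rw [rCoef, corr, hM.covariance_V_Lam hσ.ne' α hn, hM.variance_V hσ.ne' hn,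
    hM.variance_Lam hσ.ne', ← Real.sqrt_mul (by positivity),
    show M.sigmaSq x * ((τ : ℝ) - n) * (M.sigmaSq x * quadForm α l τ)
      = M.sigmaSq x ^ 2 * (((τ : ℝ) - n) * quadForm α l τ) by ring,
    Real.sqrt_mul (sq_nonneg _), Real.sqrt_sq hσ.le, mul_div_mul_left _ _ hσ.ne']

end Market

namespace Market

/-! ### The jump part of the log-returns -/

variable {m : ℕ} {Ω : Type*} (M : Market m Ω)

lemma sigma_le_biSup {S : Set (Source m)} {s : Source m} (hs : s ∈ S) :
    M.sigma s ≤ ⨆ i ∈ S, M.sigma i :=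
  le_iSup₂ (f := fun i (_ : i ∈ S) => M.sigma i) s hs

lemma measurable_N_sigma (t : ℝ≥0) : Measurable[M.sigma .common] (M.N t) :=
  measurable_iff_comap_le.2
    (le_iSup (fun t : ℝ≥0 => MeasurableSpace.comap (M.N t) inferInstance) t)

lemma measurable_NOwn_sigma (j : Fin m) (t : ℝ≥0) : Measurable[M.sigma (.own j)] (M.NOwn j t) :=
  measurable_iff_comap_le.2
    (le_iSup (fun t : ℝ≥0 => MeasurableSpace.comap (M.NOwn j t) inferInstance) t)

lemma measurable_Zstar_sigma (x : Fin m → ℝ) (k : ℕ) (j : Fin m) (ℓ : Fin 2) :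
    Measurable[M.sigma (.jump k j ℓ)] (M.Zstar x k j ℓ) := by
  have h : Measurable[M.sigma (.jump k j ℓ)] (M.Z k j ℓ) := comap_measurable _
  unfold Zstar
  fun_prop

/-- The multiplicative size `exp Z*` of a jump, as an extended nonnegative real. -/
noncomputable def jumpFactor (x : Fin m → ℝ) (k : ℕ) (j : Fin m) (ℓ : Fin 2) (ω : Ω) : ℝ≥0∞ :=
  ENNReal.ofReal (Real.exp (M.Zstar x k j ℓ ω))

lemma measurable_jumpFactor_sigma (x : Fin m → ℝ) (k : ℕ) (j : Fin m) (ℓ : Fin 2) :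
    Measurable[M.sigma (.jump k j ℓ)] (M.jumpFactor x k j ℓ) :=
  ENNReal.measurable_ofReal.comp (Real.measurable_exp.comp (M.measurable_Zstar_sigma x k j ℓ))

/-- The sources entering the common jumps (`none`), or the individual jumps of asset `j`
(`some j`): a clock and the sizes of the jumps it triggers. -/
def clockGroup : Option (Fin m) → Set (Source m)
  | none => {.common} ∪ Set.range fun p : ℕ × Fin m => .jump p.1 p.2 0
  | some j => {.own j} ∪ Set.range fun k : ℕ => .jump k j 1

lemma pairwise_disjoint_clockGroup :
    Pairwise fun a b : Option (Fin m) => Disjoint (clockGroup a) (clockGroup b) := by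
  rintro (_ | i) (_ | j) hij <;> rw [Set.disjoint_left] <;> rintro s hs hs' <;>
    simp only [clockGroup, Set.mem_union, Set.mem_singleton_iff, Set.mem_range] at hs hs' <;>
    aesop

lemma clockGroup_subset (a : Option (Fin m)) : clockGroup a ⊆ {Source.brownian}ᶜ := by
  rintro s hs
  cases a <;> simp only [clockGroup, Set.mem_union, Set.mem_singleton_iff, Set.mem_range] at hs <;>
    aesop

/-- The factor by which the jumps of one clock multiply the portfolio over `(n, τ]`. -/
noncomputable def clockFactor (x : Fin m → ℝ) (τ n : ℕ) : Option (Fin m) → Ω → ℝ≥0∞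
  | none => fun ω => ∏ k ∈ Finset.Ico (M.N n ω) (M.N τ ω), ∏ j, M.jumpFactor x k j 0 ω
  | some j => fun ω => ∏ k ∈ Finset.Ico (M.NOwn j n ω) (M.NOwn j τ ω), M.jumpFactor x k j 1 ω

lemma measurable_clockFactor (x : Fin m → ℝ) (τ n : ℕ) (a : Option (Fin m)) :
    Measurable[⨆ i ∈ clockGroup a, M.sigma i] (M.clockFactor x τ n a) := by
  cases a with
  | none =>
    refine measurable_of_counts (m := ⨆ i ∈ clockGroup none, M.sigma i)
      (f := fun a b ω => ∏ k ∈ Finset.Ico a b, ∏ j, M.jumpFactor x k j 0 ω) (fun a b => ?_)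
      ((M.measurable_N_sigma n).mono (M.sigma_le_biSup (by simp [clockGroup])) le_rfl)
      ((M.measurable_N_sigma τ).mono (M.sigma_le_biSup (by simp [clockGroup])) le_rfl)
    exact Finset.measurable_fun_prod _ fun k _ => Finset.measurable_fun_prod _ fun j _ =>
      (M.measurable_jumpFactor_sigma x k j 0).mono (M.sigma_le_biSup (by simp [clockGroup])) le_rfl
  | some j =>
    refine measurable_of_counts (m := ⨆ i ∈ clockGroup (some j), M.sigma i)
      (f := fun a b ω => ∏ k ∈ Finset.Ico a b, M.jumpFactor x k j 1 ω) (fun a b => ?_)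
      ((M.measurable_NOwn_sigma j n).mono (M.sigma_le_biSup (by simp [clockGroup])) le_rfl)
      ((M.measurable_NOwn_sigma j τ).mono (M.sigma_le_biSup (by simp [clockGroup])) le_rfl)
    exact Finset.measurable_fun_prod _ fun k _ =>
      (M.measurable_jumpFactor_sigma x k j 1).mono (M.sigma_le_biSup (by simp [clockGroup])) le_rfl

/-- The factor by which all the jumps multiply the portfolio over `(n, τ]`. -/
noncomputable def jumpGrowth (x : Fin m → ℝ) (τ n : ℕ) (ω : Ω) : ℝ :=
  Real.exp (∑ j, ∑ k ∈ Finset.Ico (M.N n ω) (M.N τ ω), M.Zstar x k j 0 ω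
    + ∑ j, ∑ k ∈ Finset.Ico (M.NOwn j n ω) (M.NOwn j τ ω), M.Zstar x k j 1 ω)

lemma jumpGrowth_nonneg (x : Fin m → ℝ) (τ n : ℕ) (ω : Ω) : 0 ≤ M.jumpGrowth x τ n ω :=
  (Real.exp_pos _).le

lemma ofReal_jumpGrowth (x : Fin m → ℝ) (τ n : ℕ) (ω : Ω) :
    ENNReal.ofReal (M.jumpGrowth x τ n ω) = ∏ a, M.clockFactor x τ n a ω := by
  have h : ∀ (ι : Type) (s : Finset ι) (f : ι → ℝ),
      ENNReal.ofReal (∏ i ∈ s, Real.exp (f i)) = ∏ i ∈ s, ENNReal.ofReal (Real.exp (f i)) :=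
    fun ι s f => ENNReal.ofReal_prod_of_nonneg fun i _ => (Real.exp_pos _).le
  rw [Fintype.prod_option]
  simp only [clockFactor, jumpFactor, jumpGrowth]
  rw [Finset.sum_comm, Real.exp_add, ENNReal.ofReal_mul (Real.exp_pos _).le]
  simp only [Real.exp_sum, ← h]
  congr 1
  · rw [ENNReal.ofReal_prod_of_nonneg fun i _ => by positivity]
  · rw [ENNReal.ofReal_prod_of_nonneg fun i _ => by positivity]

lemma measurable_jumpGrowth_sigma (x : Fin m → ℝ) (τ n : ℕ) :
    Measurable[⨆ i ∈ ({Source.brownian}ᶜ : Set (Source m)), M.sigma i]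
      (M.jumpGrowth x τ n) := by
  have h : M.jumpGrowth x τ n = fun ω => (∏ a, M.clockFactor x τ n a ω).toReal := by
    funext ω
    rw [← ofReal_jumpGrowth, ENNReal.toReal_ofReal (M.jumpGrowth_nonneg x τ n ω)]
  rw [h]
  refine ENNReal.measurable_toReal.comp (Finset.measurable_fun_prod _ fun a _ => ?_)
  exact (M.measurable_clockFactor x τ n a).mono
    (biSup_mono fun i hi => clockGroup_subset a hi) le_rfl

variable {M} [MeasurableSpace Ω] {P : Measure Ω}

lemma IsMerton.lintegral_jumpFactor [IsProbabilityMeasure P] (hM : M.IsMerton P) {x : Fin m → ℝ}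
    (hx : M.Admissible P x) (k : ℕ) (j : Fin m) (ℓ : Fin 2) :
    ∫⁻ ω, M.jumpFactor x k j ℓ ω ∂P = ENNReal.ofReal (mgf (M.Zstar x 0 j ℓ) P 1) := by
  have hid : IdentDistrib (M.jumpFactor x k j ℓ) (M.jumpFactor x 0 j ℓ) P P :=
    (hM.identDistrib k j ℓ).comp
      (u := fun z => ENNReal.ofReal (Real.exp (Real.log (1 + x j * (Real.exp z - 1)))))
      (by fun_prop)
  have hint : Integrable (fun ω => Real.exp (M.Zstar x 0 j ℓ ω)) P := by
    refine Integrable.congr (f := fun ω => 1 + x j * (Real.exp (M.Z 0 j ℓ ω) - 1)) ?_ ?_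
    · exact (integrable_const 1).add
        (((hM.integrable_exp j ℓ).sub (integrable_const 1)).const_mul (x j))
    · filter_upwards [hx 0 j ℓ] with ω hω
      rw [Zstar, Real.exp_log hω]
  rw [hid.lintegral_eq]
  simp only [mgf, one_mul, jumpFactor]
  exact (ofReal_integral_eq_lintegral_ofReal hint
    (Filter.Eventually.of_forall fun ω => (Real.exp_pos _).le)).symm

/-- The sizes of distinct jumps are independent, also for a common jump that hits several assets. -/
lemma IsMerton.lintegral_prod_jumpFactor [IsProbabilityMeasure P] (hM : M.IsMerton P)
    {x : Fin m → ℝ} (hx : M.Admissible P x) (ℓ : Fin 2) (s : Finset ℕ) (u : Finset (Fin m)) :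
    ∫⁻ ω, ∏ k ∈ s, ∏ j ∈ u, M.jumpFactor x k j ℓ ω ∂P
      = ENNReal.ofReal (∏ j ∈ u, mgf (M.Zstar x 0 j ℓ) P 1) ^ s.card := by
  have h := lintegral_prod_eq_prod_lintegral_of_iIndep hM.sigma_le hM.indep
    (S := fun p : ℕ × Fin m => {Source.jump p.1 p.2 ℓ})
    (f := fun p => M.jumpFactor x p.1 p.2 ℓ)
    (fun a b hab => by
      refine Set.disjoint_singleton.2 fun h => ?_
      injection h with h₁ h₂
      exact hab (Prod.ext h₁ h₂))
    (fun p => (M.measurable_jumpFactor_sigma x p.1 p.2 ℓ).mono (M.sigma_le_biSup rfl) le_rfl)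
    (s ×ˢ u)
  simp only [Finset.prod_product, hM.lintegral_jumpFactor hx] at h
  rw [h, Finset.prod_const, ENNReal.ofReal_prod_of_nonneg fun j _ => mgf_nonneg]

/-- The exponential growth rate, in the length of the window, of the mean of `clockFactor`. -/
noncomputable def clockRate (M : Market m Ω) (P : Measure Ω) (x : Fin m → ℝ) :
    Option (Fin m) → ℝ
  | none => M.lam * (∏ j, mgf (M.Zstar x 0 j 0) P 1 - 1)
  | some j => M.lamOwn j * (mgf (M.Zstar x 0 j 1) P 1 - 1)

lemma IsMerton.lintegral_clockFactor [IsProbabilityMeasure P] (hM : M.IsMerton P)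
    {x : Fin m → ℝ} (hx : M.Admissible P x) {τ n : ℕ} (hn : n ≤ τ) (a : Option (Fin m)) :
    ∫⁻ ω, M.clockFactor x τ n a ω ∂P
      = ENNReal.ofReal (Real.exp (((τ : ℝ) - n) * M.clockRate P x a)) := by
  have hn' : (n : ℝ≥0) ≤ τ := by exact_mod_cast hn
  cases a with
  | none =>
    have hdisj : Disjoint ({Source.common} : Set (Source m))
        (Set.range fun p : ℕ × Fin m => Source.jump p.1 p.2 0) := by simp
    have h := hM.common.lintegral_prod (iSup₂_le fun i _ => hM.sigma_le i)
      (iSup₂_le fun i _ => hM.sigma_le i) (indep_iSup_of_disjoint hM.sigma_le hM.indep hdisj)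
      (fun t => (M.measurable_N_sigma t).mono (M.sigma_le_biSup rfl) le_rfl)
      (X := fun k ω => ∏ j, M.jumpFactor x k j 0 ω)
      (fun k => Finset.measurable_fun_prod _ fun j _ =>
        (M.measurable_jumpFactor_sigma x k j 0).mono (M.sigma_le_biSup ⟨(k, j), rfl⟩) le_rfl)
      (c := ∏ j, mgf (M.Zstar x 0 j 0) P 1) (Finset.prod_nonneg fun j _ => mgf_nonneg)
      (fun a b => by rw [hM.lintegral_prod_jumpFactor hx, Nat.card_Ico]) hn'
    simp only [clockFactor, clockRate]
    rw [h]
    push_cast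
    ring_nf
  | some j =>
    have hdisj : Disjoint ({Source.own j} : Set (Source m))
        (Set.range fun k : ℕ => Source.jump k j 1) := by simp
    have h := (hM.own j).lintegral_prod (iSup₂_le fun i _ => hM.sigma_le i)
      (iSup₂_le fun i _ => hM.sigma_le i) (indep_iSup_of_disjoint hM.sigma_le hM.indep hdisj)
      (fun t => (M.measurable_NOwn_sigma j t).mono (M.sigma_le_biSup rfl) le_rfl)
      (X := fun k ω => M.jumpFactor x k j 1 ω)
      (fun k => (M.measurable_jumpFactor_sigma x k j 1).mono (M.sigma_le_biSup ⟨k, rfl⟩) le_rfl)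
      (c := mgf (M.Zstar x 0 j 1) P 1) mgf_nonneg
      (fun a b => by simpa using hM.lintegral_prod_jumpFactor hx 1 (Finset.Ico a b) {j}) hn'
    simp only [clockFactor, clockRate]
    rw [h]
    push_cast
    ring_nf

lemma IsMerton.lintegral_jumpGrowth [IsProbabilityMeasure P] (hM : M.IsMerton P)
    {x : Fin m → ℝ} (hx : M.Admissible P x) {τ n : ℕ} (hn : n ≤ τ) :
    ∫⁻ ω, ENNReal.ofReal (M.jumpGrowth x τ n ω) ∂P
      = ENNReal.ofReal (Real.exp (((τ : ℝ) - n) * ∑ a, M.clockRate P x a)) := by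
  simp only [ofReal_jumpGrowth]
  rw [lintegral_prod_eq_prod_lintegral_of_iIndep hM.sigma_le hM.indep
    pairwise_disjoint_clockGroup (M.measurable_clockFactor x τ n),
    Finset.prod_congr rfl fun a _ => hM.lintegral_clockFactor hx hn a,
    ← ENNReal.ofReal_prod_of_nonneg fun a _ => (Real.exp_pos _).le, ← Real.exp_sum,
    Finset.mul_sum]

lemma IsMerton.measurable_jumpGrowth (hM : M.IsMerton P) (x : Fin m → ℝ) (τ n : ℕ) :
    Measurable (M.jumpGrowth x τ n) :=
  (M.measurable_jumpGrowth_sigma x τ n).mono (iSup₂_le fun i _ => hM.sigma_le i) le_rfl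

lemma IsMerton.integrable_jumpGrowth [IsProbabilityMeasure P] (hM : M.IsMerton P)
    {x : Fin m → ℝ} (hx : M.Admissible P x) {τ n : ℕ} (hn : n ≤ τ) :
    Integrable (M.jumpGrowth x τ n) P := by
  refine ⟨(hM.measurable_jumpGrowth x τ n).aestronglyMeasurable, ?_⟩
  rw [hasFiniteIntegral_iff_ofReal (Filter.Eventually.of_forall (M.jumpGrowth_nonneg x τ n)),
    hM.lintegral_jumpGrowth hx hn]
  exact ENNReal.ofReal_lt_top

lemma IsMerton.integral_jumpGrowth [IsProbabilityMeasure P] (hM : M.IsMerton P)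
    {x : Fin m → ℝ} (hx : M.Admissible P x) {τ n : ℕ} (hn : n ≤ τ) :
    ∫ ω, M.jumpGrowth x τ n ω ∂P = Real.exp (((τ : ℝ) - n) * ∑ a, M.clockRate P x a) := by
  rw [integral_eq_lintegral_of_nonneg_ae
    (Filter.Eventually.of_forall (M.jumpGrowth_nonneg x τ n))
    (hM.measurable_jumpGrowth x τ n).aestronglyMeasurable, hM.lintegral_jumpGrowth hx hn,
    ENNReal.toReal_ofReal (Real.exp_pos _).le]

end Market

/-! ### The conditional expectation of the growth factors -/

/-- Consecutive windows of a counting path concatenate. -/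
lemma sum_Ioc_sum_Ico {a : ℕ → ℕ} (ha : Monotone a) (f : ℕ → ℝ) {n τ : ℕ} (hn : n ≤ τ) :
    ∑ k ∈ Finset.Ioc n τ, ∑ i ∈ Finset.Ico (a (k - 1)) (a k), f i
      = ∑ i ∈ Finset.Ico (a n) (a τ), f i := by
  induction τ, hn using Nat.le_induction with
  | base => simp
  | succ τ hn ih =>
    rw [Finset.sum_Ioc_succ_top (by omega), ih, Nat.add_sub_cancel,
      Finset.sum_Ico_consecutive _ (ha hn) (ha τ.le_succ)]

lemma sum_Ioc_sub (g : ℕ → ℝ) {n τ : ℕ} (hn : n ≤ τ) :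
    ∑ k ∈ Finset.Ioc n τ, (g k - g (k - 1)) = g τ - g n := by
  induction τ, hn using Nat.le_induction with
  | base => simp
  | succ τ hn ih =>
    rw [Finset.sum_Ioc_succ_top (by omega), ih, Nat.add_sub_cancel]
    ring

namespace Market

variable {m : ℕ} {Ω : Type*} {M : Market m Ω} [MeasurableSpace Ω] {P : Measure Ω}

lemma IsMerton.growth_ae_eq (hM : M.IsMerton P) (x : Fin m → ℝ) {τ n : ℕ} (hn : n ≤ τ) :
    M.growth P x τ n =ᵐ[P] fun ω => Real.exp (((τ : ℝ) - n) * (M.mu P x - M.sigmaSq x / 2))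
      * Real.exp (M.V x τ n ω) * M.jumpGrowth x τ n ω := by
  filter_upwards [hM.common.monotone, ae_all_iff.2 fun j => (hM.own j).monotone] with ω h₀ h₁
  have hcast : Monotone fun k : ℕ => (k : ℝ≥0) := Nat.mono_cast
  rw [growth, jumpGrowth, ← Real.exp_add, ← Real.exp_add]
  congr 1
  simp only [Y, Finset.sum_add_distrib]
  have e₀ : ∑ k ∈ Finset.Ioc n τ, ∑ j, ∑ i ∈ Finset.Ico (M.N ((k - 1 : ℕ) : ℝ≥0) ω)
      (M.N (k : ℝ≥0) ω), M.Zstar x i j 0 ω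
      = ∑ j, ∑ i ∈ Finset.Ico (M.N n ω) (M.N τ ω), M.Zstar x i j 0 ω := by
    rw [Finset.sum_comm]
    exact Finset.sum_congr rfl fun j _ => sum_Ioc_sum_Ico (h₀.comp hcast) _ hn
  have e₁ : ∑ k ∈ Finset.Ioc n τ, ∑ j, ∑ i ∈ Finset.Ico (M.NOwn j ((k - 1 : ℕ) : ℝ≥0) ω)
      (M.NOwn j (k : ℝ≥0) ω), M.Zstar x i j 1 ω
      = ∑ j, ∑ i ∈ Finset.Ico (M.NOwn j n ω) (M.NOwn j τ ω), M.Zstar x i j 1 ω := by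
    rw [Finset.sum_comm]
    exact Finset.sum_congr rfl fun j _ => sum_Ioc_sum_Ico ((h₁ j).comp hcast) _ hn
  rw [e₀, e₁, ← Finset.mul_sum, sum_Ioc_sub (fun k => M.BX x (k : ℝ≥0) ω) hn, Finset.sum_const,
    Nat.card_Ioc, nsmul_eq_mul, Nat.cast_sub hn, V]
  ring

/-- The growth factors are integrable, and their conditional expectations given `Λ` are the
explicit log-normal variables: the jumps, independent of the Brownian motions, contribute their
mean, and the Brownian part is regressed on `Λ`. -/
lemma IsMerton.condExp_growth [IsProbabilityMeasure P] (hM : M.IsMerton P) {x : Fin m → ℝ}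
    (hx : M.Admissible P x) (hσ : 0 < M.sigmaSq x) {l τ n : ℕ} {α : ℕ → ℝ}
    (hα : ∃ k ∈ Finset.Ico (l - 1) τ, α k ≠ 0) (hn : n ∈ Finset.Ico (l - 1) τ) :
    Integrable (M.growth P x τ n) P ∧
      P[M.growth P x τ n | M.sigmaLam x α l τ] =ᵐ[P] M.lowerGrowth P x α l τ n := by
  have hnτ : n ≤ τ := (Finset.mem_Ico.1 hn).2.le
  have hpos : (0 : ℝ) < (τ : ℝ) - n := sub_pos.2 (by exact_mod_cast (Finset.mem_Ico.1 hn).2)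
  have hLm : M.sigmaLam x α l τ ≤ M.sigma .brownian := (M.measurable_Lam_sigma x α l τ).comap_le
  have hL : Measurable (M.Lam x α l τ) :=
    (M.measurable_Lam_sigma x α l τ).mono (hM.sigma_le _) le_rfl
  have hG := hM.hasGaussianLaw_V_Lam hσ.ne' α hn
  have hVv := hM.variance_V hσ.ne' hnτ
  have hVpos : 0 < Var[M.V x τ n; P] := by
    rw [hVv]
    positivity
  have hLpos : 0 < Var[M.Lam x α l τ; P] := by
    rw [hM.variance_Lam hσ.ne']
    exact mul_pos hσ (quadForm_pos hα)
  set K := Real.exp (((τ : ℝ) - n) * (M.mu P x - M.sigmaSq x / 2)) with hK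
  set Y : Ω → ℝ := K • fun ω => Real.exp (M.V x τ n ω) with hY
  have hYm : Measurable[M.sigma .brownian] Y :=
    (Real.measurable_exp.comp (M.measurable_V_sigma x τ n)).const_smul K
  have hYi : Integrable Y P := (integrable_exp_of_hasGaussianLaw hG.fst).smul K
  have hind : Indep (⨆ i ∈ ({Source.brownian}ᶜ : Set (Source m)), M.sigma i)
      (M.sigma .brownian) P := by
    have h := indep_iSup_of_disjoint hM.sigma_le hM.indep
      (disjoint_compl_left (a := ({Source.brownian} : Set (Source m))))
    exact indep_of_indep_of_le_right h (M.sigma_le_biSup rfl)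
  obtain ⟨hint, hcond⟩ := condExp_mul_of_indep (iSup₂_le fun i _ => hM.sigma_le i)
    (hM.sigma_le .brownian) hLm hind (M.measurable_jumpGrowth_sigma x τ n) hYm
    (hM.integrable_jumpGrowth hx hnτ) hYi
  have hgrowth : M.growth P x τ n =ᵐ[P] Y * M.jumpGrowth x τ n := hM.growth_ae_eq x hnτ
  refine ⟨hint.congr hgrowth.symm, (condExp_congr_ae hgrowth).trans (hcond.trans ?_)⟩
  have hexp := condExp_exp_of_hasGaussianLaw hL hG (hM.integral_V hσ.ne' τ n)
    (hM.integral_Lam hσ.ne' α l τ) hVpos hLpos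
  have hsmul : P[Y | M.sigmaLam x α l τ]
      =ᵐ[P] K • P[fun ω => Real.exp (M.V x τ n ω) | M.sigmaLam x α l τ] := condExp_smul _ _ _
  filter_upwards [hsmul, hexp] with ω h₁ h₂
  rw [h₁, Pi.smul_apply, h₂, hM.integral_jumpGrowth hx hnτ, smul_eq_mul, hK, ← Real.exp_add,
    ← Real.exp_add, lowerGrowth]
  congr 1
  rw [hVv, Real.sqrt_mul hσ.le, c₁, c₂, c₃, mu, Fintype.sum_option]
  simp only [clockRate, rCoef, sdLam]
  ring

lemma IsMerton.rCoef_nonneg (hM : M.IsMerton P) {x : Fin m → ℝ} (hσ : 0 < M.sigmaSq x)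
    {α : ℕ → ℝ} {l τ n : ℕ} (hn : n ≤ τ) (hα : ∀ k ∈ Finset.Ico (l - 1) τ, 0 ≤ α k) :
    0 ≤ M.rCoef P x α l τ n := by
  rw [hM.rCoef_eq hσ α hn]
  refine div_nonneg (Finset.sum_nonneg fun k hk => mul_nonneg (hα k hk) (le_min ?_ ?_))
    (Real.sqrt_nonneg _)
  · exact sub_nonneg.2 (by exact_mod_cast hn)
  · exact sub_nonneg.2 (by exact_mod_cast (Finset.mem_Ico.1 hk).2.le)

end Market

/-! ### Convex order and comonotonicity -/

/-- A conditional expectation is smaller in convex order, by Jensen's inequality. -/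
lemma convexOrder_of_condExp {Ω : Type*} {m' mΩ : MeasurableSpace Ω} {P : Measure Ω}
    [IsProbabilityMeasure P] (hm : m' ≤ mΩ) {X Y : Ω → ℝ} (hY : Integrable Y P)
    (h : P[Y | m'] =ᵐ[P] X) : ConvexOrder X Y P := by
  have hX : Integrable X P := integrable_condExp.congr h
  refine ⟨hX, hY, ?_, fun d => ?_⟩
  · rw [← integral_congr_ae h, integral_condExp hm]
  · have hYd : Integrable (fun ω => Y ω - d) P := hY.sub (integrable_const d)
    have hmax : Integrable (fun ω => max (Y ω - d) 0) P := hYd.pos_part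
    have h₁ : P[fun ω => Y ω - d | m'] ≤ᵐ[P] P[fun ω => max (Y ω - d) 0 | m'] :=
      condExp_mono hYd hmax (Filter.Eventually.of_forall fun ω => le_max_left _ _)
    have h₂ : 0 ≤ᵐ[P] P[fun ω => max (Y ω - d) 0 | m'] :=
      condExp_nonneg (Filter.Eventually.of_forall fun ω => le_max_right _ _)
    have h₃ : P[fun ω => Y ω - d | m'] =ᵐ[P] P[Y | m'] - P[fun _ : Ω => d | m'] :=
      condExp_sub hY (integrable_const d) m'
    rw [← integral_condExp hm (f := fun ω => max (Y ω - d) 0)]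
    refine integral_mono_ae (hX.sub (integrable_const d)).pos_part integrable_condExp ?_
    filter_upwards [h, h₁, h₂, h₃] with ω e e₁ e₂ e₃
    rw [e₃, Pi.sub_apply, e, condExp_const hm] at e₁
    exact max_le e₁ e₂

/-- A vector whose components are almost surely non-decreasing functions of one random variable is
comonotonic. -/
lemma isComonotonic_of_ae_eq {Ω ι : Type*} [MeasurableSpace Ω] {P : Measure Ω}
    [IsProbabilityMeasure P] [Countable ι] {X : ι → Ω → ℝ} {L : Ω → ℝ} (hL : Measurable L)
    {f : ι → ℝ → ℝ} (hf : ∀ i, Monotone (f i)) (h : ∀ i, X i =ᵐ[P] fun ω => f i (L ω)) :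
    IsComonotonic X P := by
  refine ⟨P.map L, Measure.isProbabilityMeasure_map hL.aemeasurable, f, hf, ?_⟩
  rw [Measure.map_map (measurable_pi_lambda _ fun i => (hf i).measurable) hL]
  refine Measure.map_congr ?_
  filter_upwards [ae_all_iff.2 h] with ω hω
  exact funext hω

end MertonPortfolio

theorem mainTheorem2 {Ω : Type*} [MeasurableSpace Ω] (P : Measure Ω) [IsProbabilityMeasure P]
    {m : ℕ} (M : MertonPortfolio.Market m Ω) (hM : M.IsMerton P)
    (x : Fin m → ℝ) (hx : M.Admissible P x) (hσ : 0 < M.sigmaSq x)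
    (l τ : ℕ) (hl : 1 ≤ l) (hlτ : l ≤ τ)
    (α : ℕ → ℝ) (hα : ∃ k ∈ Finset.Ico (l - 1) τ, α k ≠ 0) (w : ℝ) :
    -- the moments of the conditioning variable
    (0 < M.sdLam P x α l τ ∧
      M.sdLam P x α l τ ^ 2 = M.sigmaSq x * MertonPortfolio.quadForm α l τ ∧
      ∀ n ∈ Finset.Ico (l - 1) τ, M.rCoef P x α l τ n =
        (∑ k ∈ Finset.Ico (l - 1) τ, α k * min ((τ : ℝ) - n) ((τ : ℝ) - k)) /
          √(((τ : ℝ) - n) * MertonPortfolio.quadForm α l τ)) ∧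
    -- the explicit form of the conditional expectation
    Integrable (M.terminalWealth P x α w l τ) P ∧
    P[M.terminalWealth P x α w l τ | M.sigmaLam x α l τ] =ᵐ[P] M.lowerWealth P x α w l τ ∧
    -- it is a lower bound in convex order
    MertonPortfolio.ConvexOrder (M.lowerWealth P x α w l τ) (M.terminalWealth P x α w l τ) P ∧
    -- it is a comonotonic sum
    (0 ≤ w → (∀ k ∈ Finset.Ico (l - 1) τ, 0 ≤ α k) →
      MertonPortfolio.IsComonotonic (fun n : Finset.Ico (l - 1) τ =>
        P[M.contribution P x α w l τ n | M.sigmaLam x α l τ]) P) := by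
  have hQ := MertonPortfolio.quadForm_pos hα
  have hvar := hM.variance_Lam hσ.ne' α l τ
  have hL : Measurable (M.Lam x α l τ) :=
    (M.measurable_Lam_sigma x α l τ).mono (hM.sigma_le _) le_rfl
  have hfirst : l - 1 ∈ Finset.Ico (l - 1) τ := Finset.mem_Ico.2 ⟨le_rfl, by omega⟩
  have hlater : ∀ j ∈ Finset.Ico l τ, j ∈ Finset.Ico (l - 1) τ := fun j hj => by
    rw [Finset.mem_Ico] at hj ⊢
    omega
  have hterm : ∀ (c : ℝ) n, n ∈ Finset.Ico (l - 1) τ →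
      Integrable (fun ω => c * M.growth P x τ n ω) P ∧
      P[fun ω => c * M.growth P x τ n ω | M.sigmaLam x α l τ]
        =ᵐ[P] fun ω => c * M.lowerGrowth P x α l τ n ω := by
    intro c n hn
    obtain ⟨hint, hcond⟩ := hM.condExp_growth hx hσ hα hn
    refine ⟨hint.const_mul c, ?_⟩
    have hs : P[fun ω => c * M.growth P x τ n ω | M.sigmaLam x α l τ]
        =ᵐ[P] c • P[M.growth P x τ n | M.sigmaLam x α l τ] := condExp_smul c _ _
    filter_upwards [hs, hcond] with ω e₁ e₂
    rw [e₁, Pi.smul_apply, e₂, smul_eq_mul]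
  have hsum : Integrable (∑ j ∈ Finset.Ico l τ, fun ω => α j * M.growth P x τ j ω) P :=
    integrable_finsetSum' _ fun j hj => (hterm (α j) j (hlater j hj)).1
  have hW : M.terminalWealth P x α w l τ = (fun ω => w * M.growth P x τ (l - 1) ω)
      + ∑ j ∈ Finset.Ico l τ, fun ω => α j * M.growth P x τ j ω := by
    funext ω
    simp [MertonPortfolio.Market.terminalWealth]
  have hWi : Integrable (M.terminalWealth P x α w l τ) P :=
    hW ▸ (hterm w _ hfirst).1.add hsum
  have hcond : P[M.terminalWealth P x α w l τ | M.sigmaLam x α l τ]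
      =ᵐ[P] M.lowerWealth P x α w l τ := by
    rw [hW]
    have h₁ := condExp_add (hterm w _ hfirst).1 hsum (M.sigmaLam x α l τ)
    have h₂ := condExp_finsetSum (s := Finset.Ico l τ)
      (f := fun j ω => α j * M.growth P x τ j ω) (μ := P)
      (fun j hj => (hterm (α j) j (hlater j hj)).1) (M.sigmaLam x α l τ)
    have h₃ := (ae_all_iff (ι := Finset.Ico l τ)).2 fun j =>
      (hterm (α j) j (hlater j j.2)).2
    filter_upwards [h₁, h₂, h₃, (hterm w _ hfirst).2] with ω e₁ e₂ e₃ e₄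
    rw [e₁, Pi.add_apply, e₂, e₄, Finset.sum_apply, MertonPortfolio.Market.lowerWealth]
    congr 1
    exact Finset.sum_congr rfl fun j hj => e₃ ⟨j, hj⟩
  have hle : M.sigmaLam x α l τ ≤ ‹MeasurableSpace Ω› := hL.comap_le
  refine ⟨⟨?_, ?_, fun n hn => hM.rCoef_eq hσ α (Finset.mem_Ico.1 hn).2.le⟩, hWi, hcond,
    MertonPortfolio.convexOrder_of_condExp hle hWi hcond, fun hw hα0 => ?_⟩
  · rw [MertonPortfolio.Market.sdLam, hvar]
    positivity
  · rw [MertonPortfolio.Market.sdLam, hvar, Real.sq_sqrt (by positivity)]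
  · refine MertonPortfolio.isComonotonic_of_ae_eq hL
      (f := fun n : Finset.Ico (l - 1) τ => fun z => (if (n : ℕ) = l - 1 then w else α n)
        * Real.exp (M.c₁ P x τ n + M.c₂ P x α l τ n
          + M.c₃ P x α l τ n * √(M.sigmaSq x) * (z / M.sdLam P x α l τ)))
      (fun n => ?_) (fun n => (hterm _ n n.2).2)
    have hcoef : 0 ≤ if (n : ℕ) = l - 1 then w else α n := by
      split_ifs
      exacts [hw, hα0 n n.2]
    have hc₃ : 0 ≤ M.c₃ P x α l τ n :=
      mul_nonneg (Real.sqrt_nonneg _) (hM.rCoef_nonneg hσ (Finset.mem_Ico.1 n.2).2.le hα0)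
    have hsd : 0 ≤ M.sdLam P x α l τ := Real.sqrt_nonneg _
    intro z z' hz
    dsimp only
    gcongr
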